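/- Let $?:[0,1]\to[0,1]$ be the Minkowski question mark function, defined on regular continued fractions by $$?([0;a_1,a_2,a_3,\ldots])=2\sum_{i\ge 1}(-1)^{i+1}2^{-(a_1+\cdots+a_i)}$$ (the sum is finite when the continued fraction terminates, so $?(0)=0$ and $?(1)=1$), and let $$d_n=\int_0^1 e^{2\pi i n x}\,\mathrm{d}?(x),\qquad n=1,2,3,\ldots,$$ be its Fourier--Stieltjes coefficients. The Dirichlet series $\mathfrak{M}(s)=\sum_{n=1}^{\infty}d_n n^{-s}$ converges (in the sense of limits of its partial sums) for $\Re(s)>0$, and $\mathfrak{M}$ extends to an entire function on $\mathbb{C}$. This extension satisfies $\mathfrak{M}(-k)=0$ for $k=2,4,6,\ldots$, and $\mathfrak{M}(0)=-\frac12$. -/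

import Mathlib

open Filter Topology MeasureTheory

/-- The `i`-th summand (counted from `0`) of
`∑_{i ≥ 1} (-1)^(i+1) 2^(-(a₁ + ⋯ + aᵢ))`, where `a₁, a₂, …` are the partial quotients of the
regular continued fraction of `x`; it is `0` once the continued fraction has terminated. -/
noncomputable def questionTerm (x : ℝ) (i : ℕ) : ℝ :=
  open Classical in
  if (GenContFract.of x).TerminatedAt i then 0
  else (-1) ^ i * (2 : ℝ) ^
    (-∑ j ∈ Finset.range (i + 1), ((GenContFract.of x).partDens.get? j).getD 0)

/-- The Minkowski question mark function
`?([a₀; a₁, a₂, …]) = a₀ + 2 ∑_{i ≥ 1} (-1)^(i+1) 2^(-(a₁ + ⋯ + aᵢ))`.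
On `[0, 1)` we have `a₀ = 0`. The point `1` has the expansion `[1]`, which gives `?(1) = 1`, the
same value as the expansion `[0; 1]`. -/
noncomputable def questionMark (x : ℝ) : ℝ :=
  (GenContFract.of x).h + 2 * ∑' i : ℕ, questionTerm x i

/-! Monotonicity of the question mark function, needed for its Stieltjes measure. -/

theorem questionTerm_of_fract_eq_zero {x : ℝ} (hx : Int.fract x = 0) (i : ℕ) :
    questionTerm x i = 0 := by
  have h : (GenContFract.of x).TerminatedAt i := by
    obtain ⟨a, rfl⟩ : ∃ a : ℤ, x = a := ⟨⌊x⌋, by rw [← Int.floor_add_fract x, hx]; simp⟩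
    rw [GenContFract.terminatedAt_iff_s_none, GenContFract.of_s_of_int]
    rfl
  simp [questionTerm, h]

theorem questionDigit_zero {x : ℝ} (hx : Int.fract x ≠ 0) :
    (GenContFract.of x).partDens.get? 0 = some (⌊(Int.fract x)⁻¹⌋ : ℝ) :=
  GenContFract.partDen_eq_s_b (g := GenContFract.of x) (n := 0) (GenContFract.of_s_head hx)

theorem questionDigit_succ (x : ℝ) (j : ℕ) :
    (GenContFract.of x).partDens.get? (j + 1) =
      (GenContFract.of (Int.fract x)⁻¹).partDens.get? j := by
  simp only [GenContFract.partDens, Stream'.Seq.map_get?, GenContFract.of_s_succ]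

theorem questionTerm_zero {x : ℝ} (hx : Int.fract x ≠ 0) :
    questionTerm x 0 = (2 : ℝ) ^ (-(⌊(Int.fract x)⁻¹⌋ : ℝ)) := by
  have h : ¬ (GenContFract.of x).TerminatedAt 0 := by
    rw [GenContFract.terminatedAt_iff_partDen_none, questionDigit_zero hx]; simp
  simp [questionTerm, h, questionDigit_zero hx]

theorem questionTerm_succ {x : ℝ} (hx : Int.fract x ≠ 0) (i : ℕ) :
    questionTerm x (i + 1) =
      -(2 : ℝ) ^ (-(⌊(Int.fract x)⁻¹⌋ : ℝ)) * questionTerm (Int.fract x)⁻¹ i := by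
  have h : (GenContFract.of x).TerminatedAt (i + 1) ↔
      (GenContFract.of (Int.fract x)⁻¹).TerminatedAt i := by
    rw [GenContFract.terminatedAt_iff_partDen_none, GenContFract.terminatedAt_iff_partDen_none,
      questionDigit_succ]
  unfold questionTerm
  by_cases ht : (GenContFract.of (Int.fract x)⁻¹).TerminatedAt i
  · simp [h, ht]
  · simp only [h, ht, if_false]
    rw [Finset.sum_range_succ', questionDigit_zero hx]
    simp only [questionDigit_succ, Option.getD_some]
    rw [neg_add, Real.rpow_add two_pos]
    ring

theorem two_rpow_neg_floor_le {x : ℝ} (hx : Int.fract x ≠ 0) :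
    (2 : ℝ) ^ (-(⌊(Int.fract x)⁻¹⌋ : ℝ)) ≤ 1 / 2 := by
  have h0 : 0 < Int.fract x := lt_of_le_of_ne (Int.fract_nonneg x) (Ne.symm hx)
  have h1 : (1 : ℤ) ≤ ⌊(Int.fract x)⁻¹⌋ := by
    rw [Int.le_floor]
    exact_mod_cast (one_le_inv₀ h0).2 (Int.fract_lt_one x).le
  have h2 : (1 : ℝ) ≤ (⌊(Int.fract x)⁻¹⌋ : ℝ) := by exact_mod_cast h1
  calc (2 : ℝ) ^ (-(⌊(Int.fract x)⁻¹⌋ : ℝ)) ≤ (2 : ℝ) ^ (-1 : ℝ) :=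
        Real.rpow_le_rpow_of_exponent_le one_le_two (by linarith)
    _ = 1 / 2 := by rw [Real.rpow_neg_one]; norm_num

theorem abs_questionTerm_le (x : ℝ) (i : ℕ) : |questionTerm x i| ≤ (1 / 2 : ℝ) ^ (i + 1) := by
  induction i generalizing x with
  | zero =>
    by_cases hx : Int.fract x = 0
    · rw [questionTerm_of_fract_eq_zero hx]; norm_num
    · rw [questionTerm_zero hx, abs_of_pos (by positivity)]
      simpa using two_rpow_neg_floor_le hx
  | succ i ih =>
    by_cases hx : Int.fract x = 0
    · rw [questionTerm_of_fract_eq_zero hx, abs_zero]; positivity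
    · rw [questionTerm_succ hx, abs_mul, abs_neg, abs_of_pos (by positivity), pow_succ' _ (i + 1)]
      exact mul_le_mul (two_rpow_neg_floor_le hx) (ih _) (abs_nonneg _) (by norm_num)

theorem summable_questionTerm (x : ℝ) : Summable (questionTerm x) :=
  Summable.of_norm_bounded
    ((summable_nat_add_iff 1).2 (summable_geometric_of_lt_one (r := (1 / 2 : ℝ))
      (by norm_num) (by norm_num))) (abs_questionTerm_le x)

theorem questionSum_eq {x : ℝ} (hx : Int.fract x ≠ 0) :
    2 * ∑' i, questionTerm x i = (2 : ℝ) ^ (-(⌊(Int.fract x)⁻¹⌋ : ℝ)) *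
      (2 - 2 * ∑' i, questionTerm (Int.fract x)⁻¹ i) := by
  rw [(summable_questionTerm x).tsum_eq_zero_add, questionTerm_zero hx]
  simp only [questionTerm_succ hx]
  rw [tsum_mul_left]
  ring

theorem questionSum_bounds_aux (n : ℕ) (x : ℝ) :
    -(2 * (1 / 2 : ℝ) ^ n) ≤ 2 * ∑' i, questionTerm x i ∧
      2 * ∑' i, questionTerm x i ≤ 1 + 2 * (1 / 2 : ℝ) ^ n := by
  induction n generalizing x with
  | zero =>
    have hg : HasSum (fun i : ℕ => (1 / 2 : ℝ) ^ (i + 1)) 1 := by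
      simpa [pow_succ] using (hasSum_geometric_two).mul_right (1 / 2 : ℝ)
    have h : |∑' i, questionTerm x i| ≤ 1 :=
      (Real.norm_eq_abs _).symm.trans_le
        (tsum_of_norm_bounded (f := questionTerm x) hg (abs_questionTerm_le x))
    rw [abs_le] at h
    constructor <;> linarith [h.1, h.2]
  | succ n ih =>
    have hp : (0 : ℝ) < (1 / 2) ^ n := by positivity
    by_cases hx : Int.fract x = 0
    · simp only [questionTerm_of_fract_eq_zero hx, tsum_zero, mul_zero]
      constructor <;> rw [pow_succ] <;> linarith
    · rw [questionSum_eq hx]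
      obtain ⟨h1, h2⟩ := ih (Int.fract x)⁻¹
      have hc := two_rpow_neg_floor_le hx
      have hc0 : 0 < (2 : ℝ) ^ (-(⌊(Int.fract x)⁻¹⌋ : ℝ)) := by positivity
      generalize (2 : ℝ) ^ (-(⌊(Int.fract x)⁻¹⌋ : ℝ)) = c at *
      generalize 2 * ∑' i, questionTerm (Int.fract x)⁻¹ i = u at *
      rw [pow_succ]
      constructor <;> nlinarith

theorem questionSum_bounds (x : ℝ) :
    0 ≤ 2 * ∑' i, questionTerm x i ∧ 2 * ∑' i, questionTerm x i ≤ 1 := by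
  have hl : Tendsto (fun n : ℕ => 2 * (1 / 2 : ℝ) ^ n) atTop (𝓝 0) := by
    simpa using (tendsto_pow_atTop_nhds_zero_of_lt_one (r := (1 / 2 : ℝ))
      (by norm_num) (by norm_num)).const_mul 2
  constructor
  · refine le_of_tendsto (by simpa only [neg_zero] using hl.neg) (Eventually.of_forall fun n => ?_)
    exact (questionSum_bounds_aux n x).1
  · refine ge_of_tendsto (by simpa only [add_zero] using hl.const_add 1) (Eventually.of_forall fun n => ?_)
    exact (questionSum_bounds_aux n x).2

theorem questionSum_mono_aux (n : ℕ) (x y : ℝ) (hxy : Int.fract x ≤ Int.fract y) :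
    2 * ∑' i, questionTerm x i ≤ 2 * ∑' i, questionTerm y i + (1 / 2 : ℝ) ^ n := by
  induction n generalizing x y with
  | zero => linarith [(questionSum_bounds x).2, (questionSum_bounds y).1, pow_zero (1 / 2 : ℝ)]
  | succ n ih =>
    have hp : (0 : ℝ) < (1 / 2) ^ (n + 1) := by positivity
    by_cases hx : Int.fract x = 0
    · have := (questionSum_bounds y).1
      simp only [questionTerm_of_fract_eq_zero hx, tsum_zero, mul_zero]
      linarith
    · have hx0 : 0 < Int.fract x := lt_of_le_of_ne (Int.fract_nonneg x) (Ne.symm hx)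
      have hy0 : 0 < Int.fract y := hx0.trans_le hxy
      have hinv : (Int.fract y)⁻¹ ≤ (Int.fract x)⁻¹ := inv_anti₀ hx0 hxy
      rw [questionSum_eq hx, questionSum_eq hy0.ne']
      have hbx := questionSum_bounds (Int.fract x)⁻¹
      have hby := questionSum_bounds (Int.fract y)⁻¹
      rcases (Int.floor_mono hinv).eq_or_lt with he | hlt
      · have h := ih (Int.fract y)⁻¹ (Int.fract x)⁻¹ (by
          have h1 := Int.self_sub_floor (Int.fract y)⁻¹
          have h2 := Int.self_sub_floor (Int.fract x)⁻¹
          rw [he] at h1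
          linarith)
        have hc := two_rpow_neg_floor_le hx
        have hc0 : 0 < (2 : ℝ) ^ (-(⌊(Int.fract x)⁻¹⌋ : ℝ)) := by positivity
        have hq : (0 : ℝ) < (1 / 2) ^ n := by positivity
        rw [he, pow_succ]
        nlinarith
      · have hlt' : (⌊(Int.fract y)⁻¹⌋ : ℝ) + 1 ≤ ⌊(Int.fract x)⁻¹⌋ := by exact_mod_cast hlt
        have hc : 2 * (2 : ℝ) ^ (-(⌊(Int.fract x)⁻¹⌋ : ℝ)) ≤
            (2 : ℝ) ^ (-(⌊(Int.fract y)⁻¹⌋ : ℝ)) := by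
          calc 2 * (2 : ℝ) ^ (-(⌊(Int.fract x)⁻¹⌋ : ℝ))
              = (2 : ℝ) ^ (1 + -(⌊(Int.fract x)⁻¹⌋ : ℝ)) := by
                rw [Real.rpow_add two_pos, Real.rpow_one]
            _ ≤ _ := Real.rpow_le_rpow_of_exponent_le one_le_two (by linarith)
        have hc0 : 0 < (2 : ℝ) ^ (-(⌊(Int.fract x)⁻¹⌋ : ℝ)) := by positivity
        nlinarith

theorem questionMark_eq (x : ℝ) : questionMark x = ⌊x⌋ + 2 * ∑' i, questionTerm x i := by
  rw [questionMark, GenContFract.of_h_eq_floor]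

theorem monotone_questionMark : Monotone questionMark := by
  intro x y hxy
  rw [questionMark_eq, questionMark_eq]
  rcases (Int.floor_mono hxy).eq_or_lt with he | hlt
  · have hl : Tendsto (fun n : ℕ => (1 / 2 : ℝ) ^ n) atTop (𝓝 0) :=
      tendsto_pow_atTop_nhds_zero_of_lt_one (by norm_num) (by norm_num)
    have h : 2 * ∑' i, questionTerm x i ≤ 2 * ∑' i, questionTerm y i := by
      refine ge_of_tendsto (by simpa only [add_zero] using hl.const_add (2 * ∑' i, questionTerm y i))
        (Eventually.of_forall fun n => questionSum_mono_aux n x y ?_)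
      rw [Int.fract, Int.fract, he]; linarith
    rw [he]; linarith
  · have hlt' : (⌊x⌋ : ℝ) + 1 ≤ ⌊y⌋ := by exact_mod_cast hlt
    linarith [(questionSum_bounds x).2, (questionSum_bounds y).1]

/-- The Lebesgue-Stieltjes measure `d?(x)` on the unit interval. -/
noncomputable def questionMeasure : Measure ℝ :=
  monotone_questionMark.stieltjesFunction.measure.restrict (Set.Icc 0 1)

/-- The Laplace-Fourier transform `𝔪(t) = ∫₀¹ exp(x t) d?(x)`. -/
noncomputable def questionTransform (t : ℂ) : ℂ :=
  ∫ x : ℝ, Complex.exp (x * t) ∂questionMeasure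

/-- The Fourier-Stieltjes coefficients `d_n = 𝔪(2πin)`. -/
noncomputable def questionCoeff (n : ℕ) : ℂ :=
  questionTransform (2 * Real.pi * Complex.I * n)

/-!
The measure `d?` is generated by two self-similarities of the question mark function:
`?(x / (1 + x)) = ?(x) / 2` on the unit interval (`questionMark_div_one_add`) and
`?(1 - x) = 1 - ?(x)` (`questionMark_one_sub`). They show that `?` takes every dyadic value, hence
is continuous, and that `?(1 / (k + 1)) = 2 ^ (-k)`. So `d?` has exponentially little mass near
`0`, and by reflection near `1`: all its negative moments at both end points are finite
(`integrable_inv_pow_questionMeasure`). By reflection the coefficients `d_n` are real, so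
`d_n = ∫ cos(2πnx) d?(x)`.

The continuation follows Riemann's method for the zeta function. Averaging the Jacobi identity
between the theta functions `∑ exp(2πinx - πn²t)` and `∑ exp(-π(n + x)²t)` over `d?(x)` gives a
pair of functions `questionTheta`, `questionDualTheta` related by `t ↦ 1 / t`. The first is
`1 + 2 ∑ d_n exp(-πn²t)`, which tends to `1` exponentially fast at infinity. The second would decay
like `exp(-πδ²t)` if `x` kept distance `δ` from the integers; finiteness of the negative moments
still forces decay faster than every power of `t` after averaging (`isBigO_questionDualTheta`).
Hence the Mellin transform `π^{-s/2} Γ(s/2) 𝔐(s)` extends to `ℂ` with a single simple pole, at `0`,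
of residue `-1` (`questionFEPair`). The Gamma factor has a pole of residue `2` at `0`, so `𝔐` is
entire with `𝔐(0) = -1/2`, and the poles of the Gamma factor at the negative even integers are zeros
of `𝔐`.

For convergence on `0 < re s`: the sums `∑_{n ≤ N} exp(2πinx)` have absolute value at most
`1/x + 1/(1-x)`, which is `d?`-integrable, so the partial sums of `d_n` are bounded
(`norm_sum_questionCoeff_le`). Abel summation gives an analytic limit of the partial sums of the Dirichlet series, which agrees with
`𝔐` by the identity theorem (`tendsto_dirichlet_of_bounded_partial_sums`).
-/

/-! ### The question mark function and its measure -/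

/-- The question mark sum depends only on the fractional part. -/
theorem questionSum_congr {x y : ℝ} (h : Int.fract x = Int.fract y) :
    2 * ∑' i, questionTerm x i = 2 * ∑' i, questionTerm y i := by
  by_cases hx : Int.fract x = 0
  · simp [questionTerm_of_fract_eq_zero hx, questionTerm_of_fract_eq_zero (h ▸ hx)]
  · have hy : Int.fract y ≠ 0 := h ▸ hx
    rw [questionSum_eq hx, questionSum_eq hy, h]

theorem questionMark_add_int (x : ℝ) (n : ℤ) : questionMark (x + n) = questionMark x + n := by
  rw [questionMark_eq, questionMark_eq, questionSum_congr (Int.fract_add_intCast x n),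
    Int.floor_add_intCast]
  push_cast; ring

theorem questionMark_intCast (n : ℤ) : questionMark n = n := by
  rw [questionMark_eq]
  simp [questionTerm_of_fract_eq_zero (Int.fract_intCast n)]

theorem questionMark_zero : questionMark 0 = 0 := by
  simpa using questionMark_intCast 0

theorem questionMark_one : questionMark 1 = 1 := by
  simpa using questionMark_intCast 1

/-- The recursion `?(x) = 2^{-⌊1/x⌋} (2 - ?({1/x}))` of the question mark function. -/
theorem questionMark_of_mem_Ioc {x : ℝ} (h0 : 0 < x) (h1 : x ≤ 1) :
    questionMark x = (2 : ℝ) ^ (-(⌊x⁻¹⌋ : ℝ)) * (2 - 2 * ∑' i, questionTerm x⁻¹ i) := by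
  rcases h1.eq_or_lt with rfl | h1
  · have : Int.fract (1⁻¹ : ℝ) = 0 := by simp
    simp only [questionTerm_of_fract_eq_zero this, questionMark_one]
    norm_num
  · have hf : Int.fract x = x := Int.fract_eq_self.2 ⟨h0.le, h1⟩
    have := questionSum_eq (x := x) (by rw [hf]; exact h0.ne')
    rw [questionMark_eq, this, hf, Int.floor_eq_zero_iff.2 ⟨h0.le, h1⟩]
    simp

/-- The first of the two self-similarities which generate `?`: it is halved by `x ↦ x / (1 + x)`. -/
theorem questionMark_div_one_add {x : ℝ} (h0 : 0 ≤ x) (h1 : x ≤ 1) :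
    questionMark (x / (1 + x)) = questionMark x / 2 := by
  rcases h0.eq_or_lt with rfl | h0
  · simp [questionMark_zero]
  have hinv : (x / (1 + x))⁻¹ = x⁻¹ + (1 : ℤ) := by
    rw [inv_div]; push_cast; field_simp
  rw [questionMark_of_mem_Ioc h0 h1, questionMark_of_mem_Ioc (by positivity)
    ((div_le_one (by positivity)).2 (by linarith)), hinv, Int.floor_add_intCast,
    questionSum_congr (Int.fract_add_intCast x⁻¹ 1)]
  push_cast
  rw [neg_add, Real.rpow_add two_pos, Real.rpow_neg_one]
  ring

theorem questionMark_one_half : questionMark (1 / 2) = 1 / 2 := by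
  have := questionMark_div_one_add zero_le_one le_rfl
  rw [questionMark_one] at this
  norm_num at this ⊢
  exact this

theorem questionMark_one_sub_of_le_half {x : ℝ} (h0 : 0 ≤ x) (h1 : x ≤ 1 / 2) :
    questionMark (1 - x) = 1 - questionMark x := by
  rcases h1.eq_or_lt with rfl | h1
  · norm_num [questionMark_one_half]
  -- Write `x = u / (1 + u)`, so that `1 - x = 1 / (1 + u)` has first partial quotient `1`.
  obtain ⟨u, hu0, hu1, rfl⟩ : ∃ u : ℝ, 0 ≤ u ∧ u < 1 ∧ x = u / (1 + u) := by
    refine ⟨x / (1 - x), div_nonneg h0 (by linarith), ?_, ?_⟩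
    · rw [div_lt_one (by linarith)]; linarith
    · have : 1 - x ≠ 0 := by linarith
      field_simp; ring
  have h2 : 1 - u / (1 + u) = (1 + u)⁻¹ := by field_simp; ring
  rw [questionMark_div_one_add hu0 hu1.le, h2, questionMark_of_mem_Ioc (by positivity)
    (inv_le_one_of_one_le₀ (by linarith)), inv_inv]
  have h3 : ⌊1 + u⌋ = 1 := by
    rw [Int.floor_eq_iff]; push_cast; constructor <;> linarith
  have h4 : questionMark u = 2 * ∑' i, questionTerm (1 + u) i := by
    rw [questionMark_eq, Int.floor_eq_zero_iff.2 ⟨hu0, hu1⟩, questionSum_congr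
      (show Int.fract u = Int.fract (1 + u) by rw [Int.fract_one_add])]
    simp
  rw [h3, ← h4]
  norm_num
  ring

/-- The second self-similarity which generates `?`: the reflection symmetry. -/
theorem questionMark_one_sub (x : ℝ) : questionMark (1 - x) = 1 - questionMark x := by
  have key : ∀ y : ℝ, 0 ≤ y → y ≤ 1 → questionMark (1 - y) = 1 - questionMark y := by
    intro y h0 h1
    rcases le_total y (1 / 2) with h | h
    · exact questionMark_one_sub_of_le_half h0 h
    · have := questionMark_one_sub_of_le_half (x := 1 - y) (by linarith) (by linarith)
      rw [sub_sub_cancel] at this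
      linarith
  have h1 : 1 - x = (1 - Int.fract x) + ((-⌊x⌋ : ℤ) : ℝ) := by
    rw [Int.fract]; push_cast; ring
  have h2 := questionMark_add_int (Int.fract x) ⌊x⌋
  rw [Int.fract_add_floor] at h2
  rw [h1, questionMark_add_int, key _ (Int.fract_nonneg x) (Int.fract_lt_one x).le, h2]
  push_cast; ring

/-- Every dyadic rational of the unit interval is a value of `?`. -/
theorem exists_questionMark_eq_dyadic (n k : ℕ) (hk : k ≤ 2 ^ n) :
    ∃ x : ℝ, 0 ≤ x ∧ x ≤ 1 ∧ questionMark x = k / 2 ^ n := by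
  induction n generalizing k with
  | zero =>
    have : k = 0 ∨ k = 1 := by rw [pow_zero] at hk; omega
    rcases this with rfl | rfl
    · exact ⟨0, le_rfl, zero_le_one, by simp [questionMark_zero]⟩
    · exact ⟨1, zero_le_one, le_rfl, by simp [questionMark_one]⟩
  | succ n ih =>
    have half : ∀ j : ℕ, j ≤ 2 ^ n → ∃ x : ℝ, 0 ≤ x ∧ x ≤ 1 ∧
        questionMark x = j / 2 ^ (n + 1) := by
      intro j hj
      obtain ⟨x, h0, h1, hx⟩ := ih j hj
      refine ⟨x / (1 + x), by positivity, (div_le_one (by positivity)).2 (by linarith), ?_⟩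
      rw [questionMark_div_one_add h0 h1, hx, pow_succ, div_div]
    rcases le_total k (2 ^ n) with h | h
    · exact half k h
    · obtain ⟨x, h0, h1, hx⟩ := half (2 ^ (n + 1) - k) (by rw [pow_succ] at *; omega)
      refine ⟨1 - x, by linarith, by linarith, ?_⟩
      rw [questionMark_one_sub, hx, Nat.cast_sub hk]
      push_cast
      field_simp
      ring

/-- The range of `?` contains all dyadic rationals, so the monotone function `?` has no jumps. -/
theorem continuous_questionMark : Continuous questionMark := by
  refine monotone_questionMark.continuous_of_denseRange ?_
  refine Metric.dense_iff.2 fun y r hr => ?_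
  -- The fractional part of `y` is approximated from below by a multiple of `2 ^ (-n)`.
  obtain ⟨n, hn⟩ := exists_pow_lt_of_lt_one hr (show (1 / 2 : ℝ) < 1 by norm_num)
  have h2 : (0 : ℝ) < 2 ^ n := by positivity
  have hf0 := Int.fract_nonneg y
  have hf1 := Int.fract_lt_one y
  have hk : ⌊Int.fract y * 2 ^ n⌋₊ ≤ 2 ^ n := by
    refine Nat.floor_le_of_le ?_
    push_cast
    nlinarith
  obtain ⟨x, -, -, hx⟩ := exists_questionMark_eq_dyadic n _ hk
  refine ⟨questionMark (x + ⌊y⌋), ?_, Set.mem_range_self _⟩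
  have h3 := Nat.floor_le (show 0 ≤ Int.fract y * 2 ^ n by positivity)
  have h4 := Nat.lt_floor_add_one (Int.fract y * 2 ^ n)
  rw [questionMark_add_int, hx, Metric.mem_ball, Real.dist_eq, abs_sub_comm,
    ← sub_sub, sub_right_comm, Int.self_sub_floor, abs_lt]
  have h5 : (1 / 2 : ℝ) ^ n = 1 / 2 ^ n := by rw [div_pow, one_pow]
  rw [h5, div_lt_iff₀ h2] at hn
  constructor
  · have : (⌊Int.fract y * 2 ^ n⌋₊ : ℝ) / 2 ^ n ≤ Int.fract y := (div_le_iff₀ h2).2 h3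
    linarith
  · rw [sub_lt_iff_lt_add, ← sub_lt_iff_lt_add', lt_div_iff₀ h2]
    nlinarith

theorem stieltjesFunction_questionMark (x : ℝ) :
    monotone_questionMark.stieltjesFunction x = questionMark x := by
  rw [Monotone.stieltjesFunction_eq]
  exact continuous_questionMark.continuousAt.continuousWithinAt.rightLim_eq

theorem leftLim_stieltjesFunction_questionMark (x : ℝ) :
    Function.leftLim monotone_questionMark.stieltjesFunction x = questionMark x := by
  rw [show (monotone_questionMark.stieltjesFunction : ℝ → ℝ) = questionMark from
    funext stieltjesFunction_questionMark]
  exact continuous_questionMark.continuousAt.continuousWithinAt.leftLim_eq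

theorem questionMeasure_Icc_zero {b : ℝ} (hb : b ≤ 1) :
    questionMeasure (Set.Icc 0 b) = ENNReal.ofReal (questionMark b) := by
  rw [questionMeasure, Measure.restrict_apply measurableSet_Icc,
    Set.inter_eq_left.2 (Set.Icc_subset_Icc le_rfl hb), StieltjesFunction.measure_Icc,
    stieltjesFunction_questionMark, leftLim_stieltjesFunction_questionMark, questionMark_zero,
    sub_zero]

instance isProbabilityMeasure_questionMeasure : IsProbabilityMeasure questionMeasure := by
  constructor
  have h := questionMeasure_Icc_zero le_rfl
  rw [questionMark_one, ENNReal.ofReal_one, questionMeasure,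
    Measure.restrict_apply_self] at h
  rw [questionMeasure, Measure.restrict_apply_univ, h]

instance nullSingletonClass_questionMeasure : NullSingletonClass questionMeasure := by
  have : NullSingletonClass monotone_questionMark.stieltjesFunction.measure := by
    refine ⟨fun x => ?_⟩
    rw [StieltjesFunction.measure_singleton, stieltjesFunction_questionMark,
      leftLim_stieltjesFunction_questionMark, sub_self, ENNReal.ofReal_zero]
  rw [questionMeasure]
  infer_instance

/-- The measure `d?` lives on the open unit interval. -/
theorem ae_questionMeasure_mem_Ioo : ∀ᵐ x ∂questionMeasure, x ∈ Set.Ioo (0 : ℝ) 1 := by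
  have h1 : ∀ᵐ x ∂questionMeasure, x ∈ Set.Icc (0 : ℝ) 1 := ae_restrict_mem measurableSet_Icc
  filter_upwards [h1, compl_mem_ae_iff.2 (measure_singleton (μ := questionMeasure) 0),
    compl_mem_ae_iff.2 (measure_singleton (μ := questionMeasure) 1)] with x hx h0 h1
  exact ⟨lt_of_le_of_ne hx.1 (Ne.symm h0), lt_of_le_of_ne hx.2 h1⟩

/-- The measure `d?` is invariant under `x ↦ 1 - x`. -/
theorem measurePreserving_one_sub_questionMeasure :
    MeasurePreserving (fun x : ℝ => 1 - x) questionMeasure questionMeasure := by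
  have h : MeasurePreserving (fun x : ℝ => 1 - x) monotone_questionMark.stieltjesFunction.measure
      monotone_questionMark.stieltjesFunction.measure := by
    refine ⟨by fun_prop, ?_⟩
    refine Measure.ext_of_Ioc' _ _ (fun a b _ => ?_) (fun a b _ => ?_)
    · rw [Measure.map_apply (by fun_prop) measurableSet_Ioc, Set.preimage_const_sub_Ioc,
        StieltjesFunction.measure_Ico]
      exact ENNReal.ofReal_ne_top
    · rw [Measure.map_apply (by fun_prop) measurableSet_Ioc, Set.preimage_const_sub_Ioc,
        StieltjesFunction.measure_Ico, StieltjesFunction.measure_Ioc]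
      simp only [stieltjesFunction_questionMark, leftLim_stieltjesFunction_questionMark,
        questionMark_one_sub]
      congr 1; ring
  have := h.restrict_preimage (s := Set.Icc 0 1) measurableSet_Icc
  rw [Set.preimage_const_sub_Icc] at this
  simpa [questionMeasure] using this

theorem questionMark_inv_nat (k : ℕ) : questionMark (1 / (k + 1)) = (1 / 2) ^ k := by
  induction k with
  | zero => simp [questionMark_one]
  | succ k ih =>
    have hk : (0 : ℝ) < k + 1 := by positivity
    have := questionMark_div_one_add (x := 1 / ((k : ℝ) + 1)) (by positivity)
      ((div_le_one hk).2 (by linarith [(Nat.cast_nonneg k : (0 : ℝ) ≤ k)]))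
    rw [ih] at this
    rw [pow_succ, mul_one_div, ← this]
    congr 1
    push_cast
    field_simp

/-- All negative moments of `d?` are finite, because `?(1/(k+1)) = 2^{-k}` decays exponentially. -/
theorem integrable_inv_pow_questionMeasure (p : ℕ) :
    Integrable (fun x : ℝ => x⁻¹ ^ p) questionMeasure := by
  have hmeas : Measurable fun x : ℝ => x⁻¹ ^ p := by fun_prop
  refine ⟨hmeas.aestronglyMeasurable, ?_⟩
  -- If `k + 1 ≤ 1 / x < k + 2`, then the `k`-th indicator alone dominates `x ^ (-p)`.
  have hbound : ∀ᵐ x ∂questionMeasure, ‖x⁻¹ ^ p‖ₑ ≤ ∑' k : ℕ,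
      (Set.Icc (0 : ℝ) (1 / (k + 1))).indicator
        (fun _ => ENNReal.ofReal (((k : ℝ) + 2) ^ p)) x := by
    filter_upwards [ae_questionMeasure_mem_Ioo] with x hx
    have hx1 : 1 < x⁻¹ := (one_lt_inv₀ hx.1).2 hx.2
    have h1 : 1 ≤ ⌊x⁻¹⌋₊ := Nat.le_floor (by exact_mod_cast hx1.le)
    obtain ⟨k, hk⟩ : ∃ k, ⌊x⁻¹⌋₊ = k + 1 := Nat.exists_eq_add_of_le' h1
    have hle := Nat.floor_le (zero_le_one.trans hx1.le)
    have hlt := Nat.lt_floor_add_one x⁻¹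
    rw [hk] at hle hlt
    push_cast at hle hlt
    refine le_trans ?_ (ENNReal.le_tsum k)
    have hmem : x ∈ Set.Icc (0 : ℝ) (1 / (k + 1)) := by
      refine ⟨hx.1.le, ?_⟩
      rw [le_div_iff₀ (by positivity)]
      calc x * (k + 1) ≤ x * x⁻¹ := mul_le_mul_of_nonneg_left hle hx.1.le
        _ = 1 := mul_inv_cancel₀ hx.1.ne'
    rw [Set.indicator_of_mem hmem, Real.enorm_eq_ofReal (by have := hx.1; positivity)]
    exact ENNReal.ofReal_le_ofReal (pow_le_pow_left₀ (by linarith) (by linarith) p)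
  refine (lintegral_mono_ae hbound).trans_lt ?_
  rw [lintegral_tsum fun k => (measurable_const.indicator measurableSet_Icc).aemeasurable]
  have hterm : ∀ k : ℕ, ∫⁻ x, (Set.Icc (0 : ℝ) (1 / (k + 1))).indicator
        (fun _ => ENNReal.ofReal (((k : ℝ) + 2) ^ p)) x ∂questionMeasure =
      ENNReal.ofReal (((k : ℝ) + 2) ^ p * (1 / 2) ^ k) := by
    intro k
    rw [lintegral_indicator_const measurableSet_Icc, questionMeasure_Icc_zero
      ((div_le_one (by positivity)).2 (by linarith [(Nat.cast_nonneg k : (0 : ℝ) ≤ k)])),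
      questionMark_inv_nat, ← ENNReal.ofReal_mul (by positivity)]
  simp_rw [hterm]
  have hsum : Summable fun k : ℕ => ((k : ℝ) + 2) ^ p * (1 / 2) ^ k := by
    have h := (summable_nat_add_iff 2).2
      (summable_pow_mul_geometric_of_norm_lt_one p (r := (1 / 2 : ℝ)) (by norm_num))
    refine (h.mul_left 4).congr fun k => ?_
    push_cast
    rw [pow_add]
    ring
  rw [← ENNReal.ofReal_tsum_of_nonneg (fun k => by positivity) hsum]
  exact ENNReal.ofReal_lt_top

theorem integrable_one_sub_inv_pow_questionMeasure (p : ℕ) :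
    Integrable (fun x : ℝ => (1 - x)⁻¹ ^ p) questionMeasure :=
  measurePreserving_one_sub_questionMeasure.integrable_comp_of_integrable
    (integrable_inv_pow_questionMeasure p)

/-- By the reflection symmetry of `d?` its Fourier coefficients are real. -/
theorem questionCoeff_eq_integral_cos (n : ℕ) :
    questionCoeff n = ((∫ x, Real.cos (2 * Real.pi * x * n) ∂questionMeasure : ℝ) : ℂ) := by
  have hint : ∀ y : ℂ, y.re = 0 →
      Integrable (fun x : ℝ => Complex.exp (x * y)) questionMeasure := by
    intro y hy
    refine Integrable.of_bound (C := 1) (by fun_prop) (ae_of_all _ fun x => ?_)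
    simp [Complex.norm_exp, hy]
  have h1 : ∫ x : ℝ, Complex.exp (x * (2 * Real.pi * Complex.I * n)) ∂questionMeasure =
      ∫ x : ℝ, Complex.exp (x * -(2 * Real.pi * Complex.I * n)) ∂questionMeasure := by
    rw [← measurePreserving_one_sub_questionMeasure.integral_comp'
      (f := MeasurableEquiv.subLeft (1 : ℝ))]
    refine integral_congr_ae (ae_of_all _ fun x => ?_)
    change Complex.exp (((1 - x : ℝ) : ℂ) * _) = _
    rw [Complex.exp_eq_exp_iff_exists_int]
    exact ⟨n, by push_cast; ring⟩
  have h2 : questionCoeff n = ∫ x : ℝ, (Complex.exp (x * (2 * Real.pi * Complex.I * n)) +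
      Complex.exp (x * -(2 * Real.pi * Complex.I * n))) / 2 ∂questionMeasure := by
    rw [integral_div, integral_add (hint _ (by simp)) (hint _ (by simp)), ← h1, add_self_div_two]
    rfl
  rw [h2, ← integral_complex_ofReal]
  refine integral_congr_ae (ae_of_all _ fun x => ?_)
  simp only [Complex.ofReal_cos, Complex.cos]
  push_cast
  congr 3 <;> ring

/-! ### Theta functions averaged over the question mark measure -/

theorem abs_cosKernel_sub_one_le (x : ℝ) {t : ℝ} (ht : 0 < t) :
    |HurwitzZeta.cosKernel x t - 1| ≤ HurwitzZeta.cosKernel (0 : ℝ) t - 1 := by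
  rw [← (HurwitzZeta.hasSum_nat_cosKernel₀ x ht).tsum_eq, ← Real.norm_eq_abs]
  refine tsum_of_norm_bounded (HurwitzZeta.hasSum_nat_cosKernel₀ 0 ht) fun n => ?_
  rw [Real.norm_eq_abs, abs_mul, abs_mul, abs_two, abs_of_pos (Real.exp_pos _)]
  gcongr
  simpa using Real.abs_cos_le_one _

theorem abs_cosKernel_le (x : ℝ) {t : ℝ} (ht : 0 < t) :
    |HurwitzZeta.cosKernel x t| ≤ HurwitzZeta.cosKernel (0 : ℝ) t := by
  have h := abs_le.1 (abs_cosKernel_sub_one_le x ht)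
  exact abs_le.2 ⟨by linarith [h.1], by linarith [h.2]⟩

theorem continuous_cosKernel_left {t : ℝ} (ht : 0 < t) :
    Continuous fun x : ℝ => HurwitzZeta.cosKernel x t := by
  have h : Continuous fun x : ℝ => (HurwitzZeta.cosKernel x t : ℂ) := by
    simp only [HurwitzZeta.cosKernel_def]
    refine continuous_iff_continuousAt.2 fun x => ?_
    exact (continuousAt_jacobiTheta₂ (x : ℂ) (τ := Complex.I * t) (by simpa)).comp
      (f := fun u : ℝ => ((u : ℂ), Complex.I * (t : ℂ))) (by fun_prop)
  exact Complex.continuous_re.comp h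

theorem integrable_cosKernel {t : ℝ} (ht : 0 < t) :
    Integrable (fun x : ℝ => HurwitzZeta.cosKernel x t) questionMeasure :=
  Integrable.of_bound (continuous_cosKernel_left ht).aestronglyMeasurable _
    (ae_of_all _ fun x => abs_cosKernel_le x ht)

/-- The theta function `∫ ∑_{n ∈ ℤ} exp(2πinx - πn²t) d?(x)`. -/
noncomputable def questionTheta (t : ℝ) : ℝ :=
  ∫ x : ℝ, HurwitzZeta.cosKernel x t ∂questionMeasure

/-- The theta function `∫ ∑_{n ∈ ℤ} exp(-π(n + x)²t) d?(x)`, dual to `questionTheta`. -/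
noncomputable def questionDualTheta (t : ℝ) : ℝ :=
  ∫ x : ℝ, HurwitzZeta.evenKernel x t ∂questionMeasure

theorem questionDualTheta_eq (t : ℝ) :
    questionDualTheta t = 1 / t ^ (1 / 2 : ℝ) * questionTheta (1 / t) := by
  simp only [questionDualTheta, questionTheta, HurwitzZeta.evenKernel_functional_equation _ t,
    integral_const_mul]

theorem continuousOn_questionTheta : ContinuousOn questionTheta (Set.Ioi 0) := by
  refine continuousOn_of_forall_continuousAt fun t (ht : 0 < t) => ?_
  have hnear : ∀ᶠ u in 𝓝 t, 0 < u := eventually_gt_nhds ht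
  have hK : ContinuousAt (HurwitzZeta.cosKernel ((0 : ℝ) : UnitAddCircle)) t :=
    (HurwitzZeta.continuousOn_cosKernel _).continuousAt (Ioi_mem_nhds ht)
  refine continuousAt_of_dominated
    (bound := fun _ => HurwitzZeta.cosKernel ((0 : ℝ) : UnitAddCircle) t + 1) ?_ ?_ ?_ ?_
  · filter_upwards [hnear] with u hu
    exact (continuous_cosKernel_left hu).aestronglyMeasurable
  · filter_upwards [hnear, hK.eventually_lt continuousAt_const (lt_add_one _)] with u hu hu'
    exact ae_of_all _ fun x => (abs_cosKernel_le x hu).trans hu'.le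
  · exact integrable_const _
  · exact ae_of_all _ fun x =>
      (HurwitzZeta.continuousOn_cosKernel _).continuousAt (Ioi_mem_nhds ht)

theorem continuousOn_questionDualTheta : ContinuousOn questionDualTheta (Set.Ioi 0) := by
  have h : ContinuousOn (fun t : ℝ => 1 / t ^ (1 / 2 : ℝ) * questionTheta (1 / t))
      (Set.Ioi 0) := by
    refine ContinuousOn.mul (ContinuousOn.div continuousOn_const ?_ ?_) ?_
    · exact fun t ht => (Real.continuousAt_rpow_const _ _ (Or.inr (by norm_num))).continuousWithinAt
    · exact fun t ht => (Real.rpow_pos_of_pos ht _).ne'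
    · refine continuousOn_questionTheta.comp
        (ContinuousOn.div continuousOn_const continuousOn_id fun t ht => ne_of_gt ht) ?_
      exact fun t (ht : 0 < t) => Set.mem_Ioi.2 (one_div_pos.2 ht)
  exact h.congr fun t _ => questionDualTheta_eq t

/-- Expansion of `questionTheta` in terms of the coefficients `d_n`. -/
theorem hasSum_questionTheta {t : ℝ} (ht : 0 < t) :
    HasSum (fun n : ℕ => questionCoeff (n + 1) * Real.exp (-Real.pi * ((n : ℝ) + 1) ^ 2 * t))
      ((questionTheta t - 1) / 2) := by
  have hint : ∀ n : ℕ, Integrable (fun x : ℝ => 2 * Real.cos (2 * Real.pi * x * (n + 1)) *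
      Real.exp (-Real.pi * ((n : ℝ) + 1) ^ 2 * t)) questionMeasure := by
    intro n
    refine Integrable.of_bound (C := 2 * 1 * Real.exp (-Real.pi * ((n : ℝ) + 1) ^ 2 * t))
      (by fun_prop) (ae_of_all _ fun x => ?_)
    rw [Real.norm_eq_abs, abs_mul, abs_mul, abs_two, abs_of_pos (Real.exp_pos _)]
    gcongr
    exact Real.abs_cos_le_one _
  have hs : Summable fun n : ℕ => 2 * Real.exp (-Real.pi * ((n : ℝ) + 1) ^ 2 * t) := by
    simpa using (HurwitzZeta.hasSum_nat_cosKernel₀ 0 ht).summable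
  have h := hasSum_integral_of_summable_integral_norm hint ?_
  · simp only [(HurwitzZeta.hasSum_nat_cosKernel₀ _ ht).tsum_eq] at h
    rw [integral_sub (integrable_cosKernel ht) (integrable_const _)] at h
    have h' := (Complex.hasSum_ofReal.2 h).div_const 2
    simp only [integral_const, probReal_univ, smul_eq_mul, mul_one] at h'
    push_cast at h'
    refine h'.congr_fun fun n => ?_
    rw [questionCoeff_eq_integral_cos, integral_mul_const, integral_const_mul]
    push_cast
    ring
  · refine hs.of_nonneg_of_le (fun n => integral_nonneg fun x => norm_nonneg _) fun n => ?_
    refine (integral_mono (hint n).norm (integrable_const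
      (2 * Real.exp (-Real.pi * ((n : ℝ) + 1) ^ 2 * t))) fun x => ?_).trans (by simp)
    simp only
    rw [Real.norm_eq_abs, abs_mul, abs_mul, abs_two, abs_of_pos (Real.exp_pos _)]
    gcongr
    linarith [Real.abs_cos_le_one (2 * Real.pi * x * (n + 1))]

theorem isBigO_questionTheta_sub_one (r : ℝ) :
    (fun t => questionTheta t - 1) =O[atTop] fun t => t ^ r := by
  obtain ⟨p, hp, hO⟩ := HurwitzZeta.isBigO_atTop_cosKernel_sub ((0 : ℝ) : UnitAddCircle)
  refine (Asymptotics.IsBigO.trans ?_ hO).trans (isLittleO_exp_neg_mul_rpow_atTop hp r).isBigO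
  refine Asymptotics.IsBigO.of_bound 1 ?_
  filter_upwards [eventually_gt_atTop 0] with t ht
  have h : questionTheta t - 1 = ∫ x : ℝ, (HurwitzZeta.cosKernel x t - 1) ∂questionMeasure := by
    rw [integral_sub (integrable_cosKernel ht) (integrable_const _)]
    simp [questionTheta]
  rw [h, one_mul]
  refine (norm_integral_le_of_norm_le_const
    (C := HurwitzZeta.cosKernel ((0 : ℝ) : UnitAddCircle) t - 1)
    (ae_of_all _ fun x => abs_cosKernel_sub_one_le x ht)).trans ?_
  rw [probReal_univ, mul_one]
  exact le_abs_self _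

/-- Gaussian decay of `∑_{n ∈ ℤ} exp(-π(n + x)²t)` for `0 < x < 1`, governed by the distances of
`x` to the end points. -/
theorem evenKernel_le {x t : ℝ} (hx : x ∈ Set.Ioo (0 : ℝ) 1) (ht : 1 ≤ t) :
    HurwitzZeta.evenKernel x t ≤ (Real.exp (-(Real.pi * x ^ 2 * (t - 1))) +
      Real.exp (-(Real.pi * (1 - x) ^ 2 * (t - 1)))) * HurwitzZeta.cosKernel (0 : ℝ) 1 := by
  have h1 : HurwitzZeta.evenKernel x 1 ≤ HurwitzZeta.cosKernel (0 : ℝ) 1 := by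
    rw [HurwitzZeta.evenKernel_functional_equation]
    simpa using (le_abs_self _).trans (abs_cosKernel_le x one_pos)
  refine le_trans ?_ (mul_le_mul_of_nonneg_left h1 (by positivity))
  refine hasSum_le (fun n => ?_) (HurwitzZeta.hasSum_int_evenKernel x (zero_lt_one.trans_le ht))
    ((HurwitzZeta.hasSum_int_evenKernel x one_pos).mul_left _)
  -- For `0 ≤ n` the point `-n` is at distance at least `x` from `x`, otherwise at least `1 - x`.
  have key : Real.exp (-(Real.pi * (n + x) ^ 2 * (t - 1))) ≤
      Real.exp (-(Real.pi * x ^ 2 * (t - 1))) + Real.exp (-(Real.pi * (1 - x) ^ 2 * (t - 1))) := by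
    have hpi := Real.pi_pos
    have ht' : 0 ≤ t - 1 := by linarith
    have hx0 := hx.1
    have hx1 : 0 < 1 - x := by linarith [hx.2]
    rcases le_or_gt 0 n with hn | hn
    · have hn' : (0 : ℝ) ≤ n := by exact_mod_cast hn
      refine le_trans (Real.exp_le_exp.2 (neg_le_neg ?_)) (le_add_of_nonneg_right
        (Real.exp_pos _).le)
      gcongr
      linarith
    · have hn' : (n : ℝ) ≤ -1 := by exact_mod_cast Int.le_sub_one_of_lt hn
      refine le_trans (Real.exp_le_exp.2 (neg_le_neg ?_)) (le_add_of_nonneg_left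
        (Real.exp_pos _).le)
      rw [← neg_sq ((n : ℝ) + x)]
      gcongr
      linarith
  calc Real.exp (-Real.pi * (n + x) ^ 2 * t)
      = Real.exp (-(Real.pi * (n + x) ^ 2 * (t - 1))) * Real.exp (-Real.pi * (n + x) ^ 2 * 1) := by
        rw [← Real.exp_add]; congr 1; ring
    _ ≤ _ := mul_le_mul_of_nonneg_right key (Real.exp_pos _).le

theorem exp_neg_pi_sq_mul_le {y t : ℝ} (hy : 0 < y) (ht : 2 ≤ t) (N : ℕ) :
    Real.exp (-(Real.pi * y ^ 2 * (t - 1))) ≤ N.factorial * (y⁻¹ ^ (2 * N) * (t ^ N)⁻¹) := by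
  have hle : y ^ 2 * t ≤ Real.pi * y ^ 2 * (t - 1) := by
    have : t ≤ Real.pi * (t - 1) := by nlinarith [Real.pi_gt_three]
    calc y ^ 2 * t ≤ y ^ 2 * (Real.pi * (t - 1)) := by gcongr
      _ = _ := by ring
  have hpos : 0 < y ^ 2 * t := by positivity
  calc Real.exp (-(Real.pi * y ^ 2 * (t - 1))) ≤ Real.exp (-(y ^ 2 * t)) :=
        Real.exp_le_exp.2 (neg_le_neg hle)
    _ = (Real.exp (y ^ 2 * t))⁻¹ := Real.exp_neg _
    _ ≤ ((y ^ 2 * t) ^ N / N.factorial)⁻¹ :=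
        inv_anti₀ (by positivity) (Real.pow_div_factorial_le_exp _ hpos.le N)
    _ = _ := by
        rw [inv_div, mul_pow, ← pow_mul, inv_pow]
        field_simp

/-- The dual theta function decays faster than any power, because all negative moments of `d?` at
both end points of the unit interval are finite. -/
theorem isBigO_questionDualTheta (r : ℝ) :
    questionDualTheta =O[atTop] fun t => t ^ r := by
  obtain ⟨N, hN⟩ := exists_nat_ge (-r)
  have hint := (integrable_inv_pow_questionMeasure (2 * N)).add
    (integrable_one_sub_inv_pow_questionMeasure (2 * N))
  set K := HurwitzZeta.cosKernel ((0 : ℝ) : UnitAddCircle) 1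
  have hK0 : 0 ≤ K := (abs_nonneg _).trans (abs_cosKernel_le 0 one_pos)
  set J := ∫ x : ℝ, (x⁻¹ ^ (2 * N) + (1 - x)⁻¹ ^ (2 * N)) ∂questionMeasure
  have hJ : 0 ≤ J := integral_nonneg fun x =>
    add_nonneg ((even_two_mul N).pow_nonneg _) ((even_two_mul N).pow_nonneg _)
  refine Asymptotics.IsBigO.of_bound (N.factorial * K * J) ?_
  filter_upwards [eventually_ge_atTop 2] with t ht
  have ht0 : 0 < t := by linarith
  have h1 : ‖questionDualTheta t‖ ≤ ∫ x : ℝ, N.factorial * K * (t ^ N)⁻¹ *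
      (x⁻¹ ^ (2 * N) + (1 - x)⁻¹ ^ (2 * N)) ∂questionMeasure := by
    refine norm_integral_le_of_norm_le (hint.const_mul _) ?_
    filter_upwards [ae_questionMeasure_mem_Ioo] with x hx
    have h0 : 0 ≤ HurwitzZeta.evenKernel x t :=
      (HurwitzZeta.hasSum_int_evenKernel x ht0).nonneg fun n => (Real.exp_pos _).le
    rw [Real.norm_of_nonneg h0]
    refine (evenKernel_le hx (by linarith)).trans ?_
    refine (mul_le_mul_of_nonneg_right (add_le_add (exp_neg_pi_sq_mul_le hx.1 ht N)
      (exp_neg_pi_sq_mul_le (sub_pos.2 hx.2) ht N)) hK0).trans (le_of_eq ?_)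
    ring
  rw [integral_const_mul] at h1
  refine h1.trans ?_
  have h2 : (t ^ N)⁻¹ ≤ ‖t ^ r‖ := by
    rw [Real.norm_of_nonneg (Real.rpow_pos_of_pos ht0 _).le, ← Real.rpow_natCast,
      ← Real.rpow_neg ht0.le]
    exact Real.rpow_le_rpow_of_exponent_le (by linarith) (by linarith)
  calc N.factorial * K * (t ^ N)⁻¹ * J = N.factorial * K * J * (t ^ N)⁻¹ := by ring
    _ ≤ _ := mul_le_mul_of_nonneg_left h2 (by positivity)

/-! ### The entire continuation -/

/-- The averaged Jacobi functional equation. Only `questionTheta` has a constant term at infinity,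
so the completed zeta function has a pole at `0` alone. -/
noncomputable def questionFEPair : WeakFEPair ℂ where
  f := fun t => questionTheta t
  g := fun t => questionDualTheta t
  hf_int := (Complex.continuous_ofReal.comp_continuousOn
    continuousOn_questionTheta).locallyIntegrableOn measurableSet_Ioi
  hg_int := (Complex.continuous_ofReal.comp_continuousOn
    continuousOn_questionDualTheta).locallyIntegrableOn measurableSet_Ioi
  k := 1 / 2
  hk := one_half_pos
  ε := 1
  hε := one_ne_zero
  f₀ := 1
  g₀ := 0
  h_feq := fun x (hx : 0 < x) => by
    have : x ^ (1 / 2 : ℝ) ≠ 0 := (Real.rpow_pos_of_pos hx _).ne'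
    rw [questionDualTheta_eq, one_mul, smul_eq_mul, ← Complex.ofReal_mul, ← mul_assoc,
      mul_one_div_cancel this, one_mul]
  hf_top := fun r => by
    simpa using Complex.isBigO_ofReal_left.2 (isBigO_questionTheta_sub_one r)
  hg_top := fun r => by
    simpa using Complex.isBigO_ofReal_left.2 (isBigO_questionDualTheta r)

/-- The function `π^{-s/2} Γ(s/2) 𝔐(s)`, continued to `ℂ ∖ {0}`. It is the Mellin transform of
`(questionTheta - 1) / 2 = ∑ d_n exp(-πn²t)` at `s / 2`. -/
noncomputable def completedQuestionZeta (s : ℂ) : ℂ := questionFEPair.Λ (s / 2) / 2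

/-- The function `𝔐(s)` continued to `ℂ`. At the negative even integers the reciprocal
of `Gammaℝ` continues to `0`, and the junk value `x / 0 = 0` agrees with it; only the value at `0`,
where the completed function has a pole, has to be prescribed. -/
noncomputable def questionZeta : ℂ → ℂ :=
  Function.update (fun s => completedQuestionZeta s / Complex.Gammaℝ s) 0 (-1 / 2)

theorem differentiableAt_completedQuestionZeta {s : ℂ} (hs : s ≠ 0) :
    DifferentiableAt ℂ completedQuestionZeta s := by
  have h : DifferentiableAt ℂ questionFEPair.Λ (s / 2) :=
    questionFEPair.differentiableAt_Λ (Or.inl (div_ne_zero hs two_ne_zero)) (Or.inr rfl)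
  exact (h.comp (f := fun s : ℂ => s / 2) s (differentiableAt_id.div_const (2 : ℂ))).div_const 2

theorem completedQuestionZeta_residue_zero :
    Tendsto (fun s => s * completedQuestionZeta s) (𝓝[≠] 0) (𝓝 (-1)) := by
  have h1 : Tendsto (fun s : ℂ => s / 2) (𝓝[≠] 0) (𝓝[≠] 0) := by
    refine tendsto_nhdsWithin_iff.2 ⟨?_, ?_⟩
    · have : Tendsto (fun s : ℂ => s / 2) (𝓝 0) (𝓝 (0 / 2)) := tendsto_id.div_const 2
      rw [zero_div] at this
      exact this.mono_left nhdsWithin_le_nhds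
    · filter_upwards [self_mem_nhdsWithin] with s hs
      exact div_ne_zero hs two_ne_zero
  refine (questionFEPair.Λ_residue_zero.comp h1).congr fun s => ?_
  simp only [Function.comp_apply, completedQuestionZeta, smul_eq_mul]
  ring

theorem differentiable_questionZeta : Differentiable ℂ questionZeta := by
  intro s
  rcases ne_or_eq s 1 with hs | rfl
  · exact HurwitzZeta.differentiableAt_update_of_residue
      (fun s hs _ => differentiableAt_completedQuestionZeta hs)
      completedQuestionZeta_residue_zero s hs
  · refine ((differentiableAt_completedQuestionZeta one_ne_zero).fun_mul
      Complex.differentiable_Gammaℝ_inv.differentiableAt).congr_of_eventuallyEq ?_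
    filter_upwards [isOpen_compl_singleton.mem_nhds one_ne_zero] with x hx
    rw [questionZeta, Function.update_of_ne hx, div_eq_mul_inv]

theorem questionZeta_zero : questionZeta 0 = -1 / 2 := Function.update_self ..

theorem questionZeta_neg_even {k : ℕ} (hk : 0 < k) (he : Even k) : questionZeta (-(k : ℂ)) = 0 := by
  obtain ⟨m, rfl⟩ := he
  rw [questionZeta, Function.update_of_ne (by simpa using hk.ne'),
    Complex.Gammaℝ_eq_zero_iff.2 ⟨m, by push_cast; ring⟩, div_zero]

theorem norm_questionCoeff_le (n : ℕ) : ‖questionCoeff n‖ ≤ 1 := by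
  rw [questionCoeff_eq_integral_cos, Complex.norm_real]
  refine (norm_integral_le_of_norm_le_const (C := 1)
    (ae_of_all _ fun x => Real.abs_cos_le_one _)).trans ?_
  simp

/-- In the half plane of absolute convergence `questionZeta` is the Dirichlet series of the
coefficients `d_n`. -/
theorem hasSum_questionZeta {s : ℂ} (hs : 1 < s.re) :
    HasSum (fun n : ℕ => questionCoeff (n + 1) / ((n : ℂ) + 1) ^ s) (questionZeta s) := by
  have hs0 : 0 < s.re := zero_lt_one.trans hs
  have hF : ∀ t ∈ Set.Ioi (0 : ℝ), HasSum (fun n : ℕ => if (n : ℝ) + 1 = 0 then 0 else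
      questionCoeff (n + 1) * Real.exp (-Real.pi * ((n : ℝ) + 1) ^ 2 * t))
      (((questionTheta t : ℂ) - 1) / 2) := by
    intro t ht
    refine (hasSum_questionTheta ht).congr_fun fun n => ?_
    rw [if_neg (by positivity)]
  have hsum : Summable fun n : ℕ => ‖questionCoeff (n + 1)‖ / |(n : ℝ) + 1| ^ s.re := by
    have h := (summable_nat_add_iff 1).2 (Real.summable_one_div_nat_rpow.2 hs)
    refine h.of_nonneg_of_le (fun n => by positivity) fun n => ?_
    rw [abs_of_pos (by positivity)]
    push_cast
    gcongr
    exact norm_questionCoeff_le _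
  have hΛ : completedQuestionZeta s =
      mellin (fun t => ((questionTheta t : ℂ) - 1) / 2) (s / 2) := by
    rw [mellin_div_const, completedQuestionZeta]
    congr 1
    refine (questionFEPair.hasMellin (?_ : 1 / 2 < (s / 2).re)).2.symm
    rw [Complex.div_ofNat_re]
    linarith
  have h := (hasSum_mellin_pi_mul_sq hs0 hF hsum).div_const (Complex.Gammaℝ s)
  have hs' : s ≠ 0 := by rintro rfl; simp at hs0
  rw [← hΛ] at h
  rw [questionZeta, Function.update_of_ne hs']
  refine h.congr_fun fun n => ?_
  rw [abs_of_pos (by positivity), mul_div_assoc, mul_div_cancel_left₀ _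
    (Complex.Gammaℝ_ne_zero_of_re_pos hs0)]
  push_cast
  rfl

/-! ### Convergence in the right half plane -/

theorem norm_cpow_neg_sub_cpow_neg_le (n : ℕ) {s : ℂ} (hs : 0 < s.re) :
    ‖((n : ℂ) + 1) ^ (-s) - ((n : ℂ) + 2) ^ (-s)‖ ≤ ‖s‖ * ((n : ℝ) + 1) ^ (-(s.re + 1)) := by
  have hpos : ∀ x ∈ Set.Icc ((n : ℝ) + 1) (n + 2), 0 < x := fun x hx =>
    lt_of_lt_of_le (by positivity) hx.1
  have hderiv : ∀ x ∈ Set.Icc ((n : ℝ) + 1) (n + 2), HasDerivWithinAt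
      (fun y : ℝ => (y : ℂ) ^ (-s)) (-s * (x : ℂ) ^ (-s - 1))
      (Set.Icc ((n : ℝ) + 1) (n + 2)) x := fun x hx =>
    (hasDerivAt_ofReal_cpow_const (hpos x hx).ne' (by
      intro h
      rw [neg_eq_zero.1 h, Complex.zero_re] at hs
      exact hs.false)).hasDerivWithinAt
  have h := (convex_Icc ((n : ℝ) + 1) (n + 2)).norm_image_sub_le_of_norm_hasDerivWithin_le
    (C := ‖s‖ * ((n : ℝ) + 1) ^ (-(s.re + 1))) hderiv (fun x hx => ?_)
    (Set.right_mem_Icc.2 (by linarith)) (Set.left_mem_Icc.2 (by linarith))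
  · push_cast at h
    refine h.trans (le_of_eq ?_)
    rw [Real.norm_eq_abs, show (n : ℝ) + 1 - (n + 2) = -1 by ring]
    simp
  · rw [norm_mul, norm_neg, Complex.norm_cpow_eq_rpow_re_of_pos (hpos x hx)]
    gcongr ?_ * ?_
    rw [show (-s - 1).re = -(s.re + 1) by simp; ring]
    exact Real.rpow_le_rpow_of_nonpos (by positivity) hx.1 (by linarith)

/-- Abel summation for a Dirichlet series, with the coefficients counted from `0`. -/
theorem sum_range_dirichlet_by_parts (d : ℕ → ℂ) (s : ℂ) (N : ℕ) :
    ∑ n ∈ Finset.range N, d n * ((n : ℂ) + 1) ^ (-s) =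
      (∑ n ∈ Finset.range N, d n) * ((N : ℂ) + 1) ^ (-s) +
      ∑ n ∈ Finset.range N, (∑ k ∈ Finset.range (n + 1), d k) *
        (((n : ℂ) + 1) ^ (-s) - ((n : ℂ) + 2) ^ (-s)) := by
  induction N with
  | zero => simp
  | succ N ih =>
    rw [Finset.sum_range_succ, ih, Finset.sum_range_succ (fun n => (∑ k ∈ Finset.range (n + 1), d k)
      * (((n : ℂ) + 1) ^ (-s) - ((n : ℂ) + 2) ^ (-s))), Finset.sum_range_succ d]
    push_cast
    rw [show (N : ℂ) + 1 + 1 = N + 2 by ring]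
    ring

section AbelSummation

variable {d : ℕ → ℂ} {C : ℝ}

theorem norm_abel_term_le (hC : ∀ N, ‖∑ n ∈ Finset.range N, d n‖ ≤ C) (n : ℕ) {s : ℂ}
    (hs : 0 < s.re) :
    ‖(∑ k ∈ Finset.range (n + 1), d k) * (((n : ℂ) + 1) ^ (-s) - ((n : ℂ) + 2) ^ (-s))‖ ≤
      C * (‖s‖ * ((n : ℝ) + 1) ^ (-(s.re + 1))) := by
  rw [norm_mul]
  exact mul_le_mul (hC _) (norm_cpow_neg_sub_cpow_neg_le n hs) (norm_nonneg _)
    ((norm_nonneg _).trans (hC 0))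

theorem summable_nat_add_one_rpow_neg {δ : ℝ} (hδ : 0 < δ) :
    Summable fun n : ℕ => ((n : ℝ) + 1) ^ (-(δ + 1)) := by
  have h := (summable_nat_add_iff 1).2 (Real.summable_nat_rpow.2 (show -(δ + 1) < -1 by linarith))
  exact_mod_cast h

theorem tendsto_dirichlet_partial_sum (hC : ∀ N, ‖∑ n ∈ Finset.range N, d n‖ ≤ C) {s : ℂ}
    (hs : 0 < s.re) :
    Tendsto (fun N => ∑ n ∈ Finset.range N, d n * ((n : ℂ) + 1) ^ (-s)) atTop
      (𝓝 (∑' n : ℕ, (∑ k ∈ Finset.range (n + 1), d k) *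
        (((n : ℂ) + 1) ^ (-s) - ((n : ℂ) + 2) ^ (-s)))) := by
  simp only [sum_range_dirichlet_by_parts]
  have h1 : Tendsto (fun N : ℕ => (∑ n ∈ Finset.range N, d n) * ((N : ℂ) + 1) ^ (-s)) atTop
      (𝓝 0) := by
    have h2 : Tendsto (fun N : ℕ => C * ((N : ℝ) + 1) ^ (-s.re)) atTop (𝓝 0) := by
      simpa using ((tendsto_rpow_neg_atTop hs).comp
        (tendsto_atTop_add_const_right _ 1 tendsto_natCast_atTop_atTop)).const_mul C
    refine squeeze_zero_norm (fun N => ?_) h2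
    have h3 : ‖((N : ℂ) + 1) ^ (-s)‖ = ((N : ℝ) + 1) ^ (-s.re) := by
      have := Complex.norm_cpow_eq_rpow_re_of_pos (show (0 : ℝ) < (N : ℝ) + 1 by positivity) (-s)
      simpa using this
    rw [norm_mul, h3]
    gcongr
    exact hC N
  have h2 : Summable fun n : ℕ => (∑ k ∈ Finset.range (n + 1), d k) *
      (((n : ℂ) + 1) ^ (-s) - ((n : ℂ) + 2) ^ (-s)) :=
    Summable.of_norm_bounded (((summable_nat_add_one_rpow_neg hs).mul_left ‖s‖).mul_left C)
      fun n => norm_abel_term_le hC n hs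
  simpa using h1.add h2.hasSum.tendsto_sum_nat

theorem differentiableOn_abel_sum (hC : ∀ N, ‖∑ n ∈ Finset.range N, d n‖ ≤ C) :
    DifferentiableOn ℂ (fun s : ℂ => ∑' n : ℕ, (∑ k ∈ Finset.range (n + 1), d k) *
        (((n : ℂ) + 1) ^ (-s) - ((n : ℂ) + 2) ^ (-s))) {s | 0 < s.re} := by
  intro s (hs : 0 < s.re)
  have hC0 : 0 ≤ C := (norm_nonneg _).trans (hC 0)
  have hU : IsOpen ({w : ℂ | s.re / 2 < w.re} ∩ {w | ‖w‖ < ‖s‖ + 1}) :=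
    (isOpen_lt continuous_const Complex.continuous_re).inter
      (isOpen_lt continuous_norm continuous_const)
  have hsU : s ∈ {w : ℂ | s.re / 2 < w.re} ∩ {w | ‖w‖ < ‖s‖ + 1} :=
    ⟨half_lt_self hs, lt_add_one ‖s‖⟩
  refine ((Complex.differentiableOn_tsum_of_summable_norm
    (((summable_nat_add_one_rpow_neg (half_pos hs)).mul_left (‖s‖ + 1)).mul_left C)
    (fun n => ?_) hU fun n w hw => ?_).differentiableAt (hU.mem_nhds hsU)).differentiableWithinAt
  · have h1 : (n : ℂ) + 1 ≠ 0 := Nat.cast_add_one_ne_zero n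
    have h2 : (n : ℂ) + 2 ≠ 0 := by exact_mod_cast (by omega : n + 2 ≠ 0)
    refine Differentiable.differentiableOn ?_
    exact ((differentiable_neg.const_cpow (Or.inl h1)).sub
      (differentiable_neg.const_cpow (Or.inl h2))).const_mul _
  · have hw1 : s.re / 2 < w.re := hw.1
    refine (norm_abel_term_le hC n (by linarith)).trans ?_
    gcongr
    · exact hw.2.le
    · linarith [(Nat.cast_nonneg n : (0 : ℝ) ≤ n)]

/-- If the coefficients of a Dirichlet series have bounded partial sums, and its sum on `1 < re s`
continues analytically to `M`, then the series converges to `M` on `0 < re s`. Abel summation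
shows that the limit of the partial sums is analytic there, and the identity theorem applies. -/
theorem tendsto_dirichlet_of_bounded_partial_sums
    (hC : ∀ N, ‖∑ n ∈ Finset.range N, d n‖ ≤ C) {M : ℂ → ℂ} (hM : Differentiable ℂ M)
    (hsum : ∀ s : ℂ, 1 < s.re → HasSum (fun n : ℕ => d n * ((n : ℂ) + 1) ^ (-s)) (M s))
    {s : ℂ} (hs : 0 < s.re) :
    Tendsto (fun N => ∑ n ∈ Finset.range N, d n * ((n : ℂ) + 1) ^ (-s)) atTop (𝓝 (M s)) := by
  have hopen : IsOpen {s : ℂ | 0 < s.re} := isOpen_lt continuous_const Complex.continuous_re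
  have han := (differentiableOn_abel_sum hC).analyticOnNhd hopen
  have heq := han.eqOn_of_preconnected_of_eventuallyEq
    (hM.differentiableOn.analyticOnNhd hopen) (convex_halfSpace_re_gt 0).isPreconnected
    (z₀ := 2) (by simp) ?_
  · rw [← heq hs]
    exact tendsto_dirichlet_partial_sum hC hs
  · filter_upwards [(isOpen_lt continuous_const Complex.continuous_re).mem_nhds
      (show (2 : ℂ) ∈ {s : ℂ | 1 < s.re} by simp)] with w hw
    exact tendsto_nhds_unique (tendsto_dirichlet_partial_sum hC (zero_lt_one.trans hw))
      (hsum w hw).tendsto_sum_nat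

end AbelSummation

theorem norm_sum_exp_le {x : ℝ} (hx : x ∈ Set.Ioo (0 : ℝ) 1) (N : ℕ) :
    ‖∑ n ∈ Finset.range N, Complex.exp (x * (2 * Real.pi * Complex.I * (n + 1 : ℕ)))‖ ≤
      x⁻¹ + (1 - x)⁻¹ := by
  have hx0 := hx.1
  have hx1 : 0 < 1 - x := sub_pos.2 hx.2
  have hpi := Real.pi_pos
  set z := Complex.exp (Complex.I * ((2 * Real.pi * x : ℝ) : ℂ)) with hz
  have hz1 : ‖z‖ = 1 := by rw [hz, mul_comm, Complex.norm_exp_ofReal_mul_I]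
  have hterm : ∀ n : ℕ, Complex.exp (x * (2 * Real.pi * Complex.I * (n + 1 : ℕ))) = z * z ^ n := by
    intro n
    rw [← pow_succ', hz, ← Complex.exp_nat_mul]
    congr 1
    push_cast
    ring
  -- The concavity bound for the sine is put in terms of `x (1 - x)`, whose reciprocal is
  -- `1 / x + 1 / (1 - x)`.
  have hsin : 2 * (x * (1 - x)) ≤ Real.sin (Real.pi * x) := by
    rcases le_total x (1 / 2) with h | h
    · have := Real.mul_le_sin (x := Real.pi * x) (by positivity) (by nlinarith)
      rw [← mul_assoc, div_mul_cancel₀ _ hpi.ne'] at this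
      nlinarith
    · have := Real.mul_le_sin (x := Real.pi * (1 - x)) (by positivity) (by nlinarith)
      rw [← mul_assoc, div_mul_cancel₀ _ hpi.ne',
        show Real.pi * (1 - x) = Real.pi - Real.pi * x by ring, Real.sin_pi_sub] at this
      nlinarith
  have hxx : 0 < x * (1 - x) := by positivity
  have hnorm : 4 * (x * (1 - x)) ≤ ‖z - 1‖ := by
    rw [hz, Complex.norm_exp_I_mul_ofReal_sub_one,
      show 2 * Real.pi * x / 2 = Real.pi * x by ring]
    exact le_trans (by linarith) (le_abs_self _)
  have hne : z ≠ 1 := fun h => by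
    rw [h, sub_self, norm_zero] at hnorm; linarith
  simp only [hterm]
  rw [← Finset.mul_sum, geom_sum_eq hne, norm_mul, hz1, one_mul, norm_div]
  have hnum : ‖z ^ N - 1‖ ≤ 2 := by
    refine (norm_sub_le _ _).trans ?_
    rw [norm_pow, hz1]
    norm_num
  calc ‖z ^ N - 1‖ / ‖z - 1‖ ≤ 2 / (4 * (x * (1 - x))) := by gcongr
    _ ≤ 1 / (x * (1 - x)) := by
        rw [div_le_div_iff₀ (by positivity) hxx]; linarith
    _ = x⁻¹ + (1 - x)⁻¹ := by field_simp; ring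

/-- The partial sums of `d_n` are bounded, since the partial sums of `exp(2πinx)` are bounded by
`1/x + 1/(1-x)`, which is integrable with respect to `d?`. -/
theorem norm_sum_questionCoeff_le (N : ℕ) :
    ‖∑ n ∈ Finset.range N, questionCoeff (n + 1)‖ ≤
      ∫ x : ℝ, (x⁻¹ + (1 - x)⁻¹) ∂questionMeasure := by
  simp only [questionCoeff, questionTransform]
  rw [← integral_finsetSum]
  · refine norm_integral_le_of_norm_le ?_ ?_
    · have h := (integrable_inv_pow_questionMeasure 1).add
        (integrable_one_sub_inv_pow_questionMeasure 1)
      simp only [pow_one] at h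
      exact h
    · filter_upwards [ae_questionMeasure_mem_Ioo] with x hx
      exact norm_sum_exp_le hx N
  · intro n _
    refine Integrable.of_bound (C := 1) (by fun_prop) (ae_of_all _ fun x => ?_)
    simp [Complex.norm_exp]

theorem mainTheorem2 :
    ∃ M : ℂ → ℂ, Differentiable ℂ M ∧
      (∀ s : ℂ, 0 < s.re →
        Tendsto (fun N : ℕ => ∑ n ∈ Finset.Icc 1 N, questionCoeff n / (n : ℂ) ^ s)
          atTop (𝓝 (M s))) ∧
      (∀ k : ℕ, 0 < k → Even k → M (-(k : ℂ)) = 0) ∧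
      M 0 = -1 / 2 := by
  refine ⟨questionZeta, differentiable_questionZeta, fun s hs => ?_,
    fun k hk he => questionZeta_neg_even hk he, questionZeta_zero⟩
  refine (tendsto_dirichlet_of_bounded_partial_sums (d := fun n => questionCoeff (n + 1))
    norm_sum_questionCoeff_le differentiable_questionZeta (fun w hw => ?_) hs).congr fun N => ?_
  · simpa only [Complex.cpow_neg, ← div_eq_mul_inv] using hasSum_questionZeta hw
  · rw [← Finset.Ico_add_one_right_eq_Icc, Finset.sum_Ico_eq_sum_range, add_tsub_cancel_right]
    refine Finset.sum_congr rfl fun n _ => ?_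
    rw [Complex.cpow_neg, ← div_eq_mul_inv, add_comm 1 n]
    push_cast
    rfl
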